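/- All Banach spaces are complex. For $0<s\le 2$ an operator $T\in L(X,Y)$ is called $(s;2)$-nuclear, $T\in N_{s;2}(X,Y)$, if $Tx=\sum_{n=1}^\infty a_n\langle x_n',x\rangle y_n$ for all $x\in X$, where $x_n'\in X^*$, $\|x_n'\|\le 1$, $(a_n)\in \ell_s$, $y_n\in Y$ and $\|(y_n)\|_2^{\mathrm{weak}}:=\sup_{\|y'\|\le 1}\big(\sum_n|\langle y',y_n\rangle|^2\big)^{1/2}<\infty$; $\nu_{s;2}(T)$ denotes the infimum of $\|(a_n)\|_{\ell_s}$ over all such representations with $\|(y_n)\|_2^{\mathrm{weak}}\le 1$. **Corollary 7.** Let $m\ge 1$, let $X_1,\dots,X_{m+1}$ be Banach spaces with $X_{m+1}=X_1$, let $0<s_k\le 2$ and $T_k\in N_{s_k;2}(X_k,X_{k+1})$ for $k=1,\dots,m$. Put $1/\tilde s=\sum_{k=1}^m 1/s_k$ and let $0<t\le\tilde s$. Suppose that $T:=T_mT_{m-1}\cdots T_1:X_1\to X_1$ has finite rank. Let $(\lambda_n(T))$ be the sequence of all nonzero eigenvalues of $T$, counted with algebraic multiplicity and completed by zeros (in any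 order; such a sequence exists). Then $(\lambda_n(T))\in \ell_t\subset\ell_{\tilde s}$ and $$\|(\lambda_n(T))\|_{t}\le(\dim T(X_1))^{1/t-1/\tilde s}\prod_{k=1}^m\nu_{s_k;2}(T_k);$$ in particular, also $$\|(\lambda_n(T))\|_{\tilde s}\le(\dim T(X_1))^{1/t-1/\tilde s}\prod_{k=1}^m\nu_{s_k;2}(T_k).$$ (Equivalently, with $1/s=\sum_k 1/s_k-1/2$, $0<\tau\le s\le\infty$ and $1/t=1/\tau+1/2$: $\|(\lambda_n(T))\|_{t}\le(\dim T(X_1))^{1/\tau-1/s}\prod_{k}\nu_{s_k;2}(T_k)$.) -/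

import Mathlib

noncomputable section

/-- The weak `ℓ²` norm of a sequence in a Banach space:
the supremum of `(∑ |⟨y', yₙ⟩|²)^(1/2)` over functionals with `‖y'‖ ≤ 1`. -/
def weakTwoNorm {Y : Type*} [NormedAddCommGroup Y] [NormedSpace ℂ Y] (y : ℕ → Y) : ENNReal :=
  ⨆ (y' : StrongDual ℂ Y) (_ : ‖y'‖ ≤ 1), (∑' n, ‖y' (y n)‖ₑ ^ 2) ^ (1 / 2 : ℝ)

/-- The `ℓ_p` (quasi-)norm of a scalar sequence, for real `p > 0`.
It is meaningful for sequences in `ℓ_p`, i.e. when `∑ |aₙ|^p` converges. -/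
def lpQuasiNorm (p : ℝ) (a : ℕ → ℂ) : ℝ :=
  (∑' n, ‖a n‖ ^ p) ^ (1 / p)

/-- `T x = ∑ aₙ ⟨x'ₙ, x⟩ yₙ` for all `x`, with `‖x'ₙ‖ ≤ 1`, `(aₙ) ∈ ℓ_s` and `(yₙ)` of finite
weak `ℓ²` norm. -/
structure IsTwoNuclearRep {X Y : Type*} [NormedAddCommGroup X] [NormedSpace ℂ X]
    [NormedAddCommGroup Y] [NormedSpace ℂ Y] (s : ℝ) (T : X →L[ℂ] Y)
    (a : ℕ → ℂ) (x' : ℕ → StrongDual ℂ X) (y : ℕ → Y) : Prop where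
  norm_le_one : ∀ n, ‖x' n‖ ≤ 1
  summable : Summable fun n => ‖a n‖ ^ s
  weak_lt_top : weakTwoNorm y < ⊤
  hasSum : ∀ x, HasSum (fun n => (a n * x' n x) • y n) (T x)

/-- `T` is `(s;2)`-nuclear. -/
def IsTwoNuclear {X Y : Type*} [NormedAddCommGroup X] [NormedSpace ℂ X]
    [NormedAddCommGroup Y] [NormedSpace ℂ Y] (s : ℝ) (T : X →L[ℂ] Y) : Prop :=
  ∃ a x' y, IsTwoNuclearRep s T a x' y

/-- The quasi-norm `ν_{s;2}(T)`: the infimum of `‖(aₙ)‖_{ℓ_s}` over the representations of `T`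
that are normalised by `‖x'ₙ‖ ≤ 1` and weak `ℓ²` norm of `(yₙ)` at most `1`. -/
def twoNuclearNorm {X Y : Type*} [NormedAddCommGroup X] [NormedSpace ℂ X]
    [NormedAddCommGroup Y] [NormedSpace ℂ Y] (s : ℝ) (T : X →L[ℂ] Y) : ℝ :=
  sInf {c : ℝ | ∃ a x' y, IsTwoNuclearRep s T a x' y ∧ weakTwoNorm y ≤ 1 ∧ c = lpQuasiNorm s a}

/-- The partial products: `operatorProduct X T j` is the composition of the `T k` with `k < j`,
later indices on the left, an operator from `X 0` to `X j`. -/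
def operatorProduct {m : ℕ} (X : Fin (m + 1) → Type*) [∀ i, NormedAddCommGroup (X i)]
    [∀ i, NormedSpace ℂ (X i)] (T : ∀ k : Fin m, X k.castSucc →L[ℂ] X k.succ)
    (j : Fin (m + 1)) : X 0 →L[ℂ] X j :=
  Fin.induction (motive := fun j => X 0 →L[ℂ] X j) (ContinuousLinearMap.id ℂ (X 0))
    (fun k P => (T k).comp P) j

/-- `lam` lists the eigenvalues of `T`: every nonzero `z` occurs in `lam` exactly as often as its
algebraic multiplicity (the dimension of the generalised eigenspace `⋃ₖ ker (T - z)^k`) says.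
The remaining entries are `0`; the order is irrelevant. -/
def IsEigenvalueSeq {X : Type*} [NormedAddCommGroup X] [NormedSpace ℂ X]
    (T : X →L[ℂ] X) (lam : ℕ → ℂ) : Prop :=
  ∀ z : ℂ, z ≠ 0 → {n | lam n = z}.encard =
    Cardinal.toENat (Module.rank ℂ (Module.End.maxGenEigenspace (T : X →ₗ[ℂ] X) z))

end

section

open Module

/-! The nonzero eigenvalues live on the range of `T`, where `T` is triangular in some basis `v` with
diagonal `μ`. Each factor is `T_k = S_k A_k` through ℓ², with `A_k x = (a_l x'_l(x))_l` and `‖S_k‖ ≤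
1`. One turn round the cycle, from `A_m T_{m-1} ⋯ T_1` to the same map composed with `T`, gives maps
`Ψ_0, …, Ψ_m` into ℓ². If `G_i(j)` is the norm of the `j`-th Gram-Schmidt vector of `Ψ_i ∘ v`,
triangularity yields `|μ_j| G_0(j) ≤ G_m(j)` (`norm_mul_norm_gramSchmidt_le`), so `|μ_j|` is at most
the product of the ratios `G_k(j) / G_{k-1}(j)`.

The `k`-th ratios are bounded in ℓ_s, `s = s_k`, by the coefficients of `T_k`
(`sum_gramSchmidt_ratio_rpow_le`). The diagonal map with entries `a_l` is split: the power `s/2`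
gives a Hilbert-Schmidt step, controlled by Bessel; the rest is `N` equal powers `w` with `s/w ≥ 2`,
each controlled by Jensen. Hölder reassembles them because `1/2 + N w/s = 1/s`. Hölder over `k`
gives the exponent `st`, infima over representations give the nuclear norms, and Hölder on the
finitely many diagonal entries gives `t ≤ st`. -/

/-! ### Triangular form and multiplicities of nonzero eigenvalues -/

/-- Over an algebraically closed field every endomorphism is triangular in some basis. -/
theorem exists_triangular_family {K : Type*} [Field K] [IsAlgClosed K] (n : ℕ) :
    ∀ {V : Type*} [AddCommGroup V] [Module K V] [FiniteDimensional K V] (_ : finrank K V = n)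
      (f : V →ₗ[K] V), ∃ (v : Fin n → V) (μ : Fin n → K), LinearIndependent K v ∧
        ∀ j, f (v j) - μ j • v j ∈ Submodule.span K (v '' Set.Iio j) := by
  induction n with
  | zero =>
    intro V _ _ _ _ f
    exact ⟨Fin.elim0, Fin.elim0, linearIndependent_empty_type, fun j => j.elim0⟩
  | succ n ih =>
    intro V _ _ _ hV f
    have : Nontrivial V := Module.nontrivial_of_finrank_pos (R := K) (by omega)
    -- The kernel of an eigenvector of the transpose is an invariant hyperplane; induction applies
    -- to it, and any vector outside it completes the family with diagonal entry `c`.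
    obtain ⟨c, hc⟩ := Module.End.exists_eigenvalue (K := K) (V := Dual K V) f.dualMap
    obtain ⟨φ, hφ⟩ := hc.exists_hasEigenvector
    have hφ0 : φ ≠ 0 := hφ.2
    have hφf : ∀ x, φ (f x) = c * φ x := fun x => by
      simpa using LinearMap.congr_fun hφ.apply_eq_smul x
    have hW : ∀ x ∈ LinearMap.ker φ, f x ∈ LinearMap.ker φ := fun x hx => by
      rw [LinearMap.mem_ker] at hx ⊢
      rw [hφf, hx, mul_zero]
    have hdim : finrank K (LinearMap.ker φ) = n := by
      have h1 := Module.Dual.finrank_ker_add_one_of_ne_zero hφ0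
      omega
    obtain ⟨v, μ, hv, hμ⟩ := ih hdim (f.restrict hW)
    obtain ⟨x, hx⟩ : ∃ x, φ x ≠ 0 := by
      by_contra! h
      exact hφ0 (LinearMap.ext h)
    have hspan : Submodule.span K (Set.range fun i => (v i : V)) = LinearMap.ker φ := by
      have h1 := hv.span_eq_top_of_card_eq_finrank' (by simp [hdim])
      have h2 := congrArg (Submodule.map (LinearMap.ker φ).subtype) h1
      rw [Submodule.map_span, Submodule.map_subtype_top, ← Set.range_comp] at h2
      exact h2
    have hv' : LinearIndependent K fun i => (v i : V) :=
      hv.map' (LinearMap.ker φ).subtype (Submodule.ker_subtype _)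
    refine ⟨Fin.snoc (fun i => (v i : V)) x, Fin.snoc μ c, ?_, ?_⟩
    · rw [linearIndependent_finSnoc]
      refine ⟨hv', fun h => hx ?_⟩
      rwa [hspan] at h
    · intro j
      induction j using Fin.lastCases with
      | last =>
        have himg : (Fin.snoc (fun i => (v i : V)) x : Fin (n + 1) → V) '' Set.Iio (Fin.last n) =
            Set.range fun i => (v i : V) := by
          ext y
          constructor
          · rintro ⟨i, hi, rfl⟩
            obtain ⟨i, rfl⟩ := Fin.exists_castSucc_eq.2 (ne_of_lt hi)
            exact ⟨i, by simp⟩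
          · rintro ⟨i, rfl⟩
            exact ⟨i.castSucc, Fin.castSucc_lt_last i, by simp⟩
        rw [himg, hspan]
        simp [hφf]
      | cast j =>
        have h := Submodule.mem_map_of_mem (f := (LinearMap.ker φ).subtype) (hμ j)
        rw [Submodule.map_span, ← Set.image_comp] at h
        simp only [Fin.snoc_castSucc]
        refine Submodule.span_mono ?_ (by simpa using h)
        rintro _ ⟨i, hi, rfl⟩
        exact ⟨i.castSucc, Fin.castSucc_lt_castSucc_iff.2 hi, by simp⟩

/-- The diagonal of a triangular form lists every scalar as often as the dimension of its
generalised eigenspace says. -/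
theorem card_filter_eq_finrank_maxGenEigenspace {K V : Type*} [Field K] [DecidableEq K]
    [AddCommGroup V] [Module K V] [FiniteDimensional K V] {n : ℕ} (hn : finrank K V = n)
    (f : V →ₗ[K] V) {v : Fin n → V} {μ : Fin n → K} (hv : LinearIndependent K v)
    (hμ : ∀ j, f (v j) - μ j • v j ∈ Submodule.span K (v '' Set.Iio j)) (z : K) :
    (Finset.univ.filter fun j => μ j = z).card =
      finrank K (Module.End.maxGenEigenspace f z) := by
  have hsp := hv.span_eq_top_of_card_eq_finrank' (by simp [hn])
  let b : Basis (Fin n) K V := Basis.mk hv hsp.ge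
  have hb : ∀ j, b j = v j := fun j => Basis.mk_apply hv hsp.ge j
  have hrepr : ∀ i j, j ≤ i → b.repr (f (v j) - μ j • v j) i = 0 := by
    intro i j hij
    have hmem : f (v j) - μ j • v j ∈ Submodule.span K (b '' Set.Iio j) := by
      rw [show (b : Fin n → V) = v from funext hb]; exact hμ j
    have hs := Basis.repr_support_subset_of_mem_span b (Set.Iio j) hmem
    by_contra h
    have : i ∈ Set.Iio j := hs (by simpa using h)
    exact absurd hij (not_le.2 this)
  have hM : ∀ i j, j ≤ i → LinearMap.toMatrix b b f i j = if i = j then μ j else 0 := by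
    intro i j hij
    have h := hrepr i j hij
    rw [map_sub, map_smul, ← hb j, Basis.repr_self] at h
    rw [LinearMap.toMatrix_apply]
    simp only [Finsupp.coe_sub, Finsupp.coe_smul, Pi.sub_apply, Pi.smul_apply, sub_eq_zero] at h
    rw [h, Finsupp.single_apply]
    simp [eq_comm]
  have hchar : f.charpoly = ∏ j, (Polynomial.X - Polynomial.C (μ j)) := by
    rw [← LinearMap.charpoly_toMatrix f b, Matrix.charpoly_of_isUpperTriangular]
    · exact Finset.prod_congr rfl fun i _ => by rw [hM i i le_rfl, if_pos rfl]
    · intro i j hij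
      have hij' : j < i := hij
      rw [hM i j hij'.le, if_neg hij'.ne']
  rw [LinearMap.finrank_maxGenEigenspace_eq, hchar, ← Polynomial.count_roots,
    Polynomial.roots_prod _ _ (Finset.prod_ne_zero_iff.2 fun _ _ => Polynomial.X_sub_C_ne_zero _)]
  simp only [Polynomial.roots_X_sub_C, Multiset.count_bind, Multiset.count_singleton]
  rw [Finset.card_filter]
  simp only [Finset.sum, eq_comm]

/-- Since `z • x = f x - (f - z) x`, membership in the range passes from `(f - z) x` to `x`; start
from `(f - z)^k x = 0` and descend. -/
theorem maxGenEigenspace_le_range {K V : Type*} [Field K] [AddCommGroup V] [Module K V]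
    (f : V →ₗ[K] V) {z : K} (hz : z ≠ 0) :
    Module.End.maxGenEigenspace f z ≤ LinearMap.range f := by
  have key : ∀ (k : ℕ) (x : V), ((f - algebraMap K (End K V) z) ^ k) x ∈ LinearMap.range f →
      x ∈ LinearMap.range f := by
    intro k
    induction k with
    | zero => intro x hx; simpa using hx
    | succ k ih =>
      intro x hx
      rw [pow_succ, Module.End.mul_apply] at hx
      have h := Submodule.sub_mem _ (LinearMap.mem_range_self f x) (ih _ hx)
      rw [LinearMap.sub_apply, sub_sub_cancel] at h
      exact (Submodule.smul_mem_iff _ hz).1 h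
  intro x hx
  obtain ⟨k, hk⟩ := Module.End.mem_maxGenEigenspace f z x |>.1 hx
  refine key k x ?_
  rw [Algebra.algebraMap_eq_smul_one, hk]
  exact Submodule.zero_mem _

theorem rank_maxGenEigenspace_restrict_range {K V : Type*} [Field K] [AddCommGroup V] [Module K V]
    (f : V →ₗ[K] V) {z : K} (hz : z ≠ 0) :
    Module.rank K (Module.End.maxGenEigenspace f z) =
      Module.rank K (Module.End.maxGenEigenspace
        (f.restrict fun x (_ : x ∈ LinearMap.range f) => LinearMap.mem_range_self f x) z) := by
  rw [Module.End.maxGenEigenspace, Module.End.maxGenEigenspace, Module.End.genEigenspace_restrict]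
  exact (Submodule.comapSubtypeEquivOfLe (maxGenEigenspace_le_range f hz)).rank_eq.symm

/-- A finite rank operator is triangular on its range, and the diagonal gives its nonzero
eigenvalues with multiplicity. -/
theorem exists_triangular_family_range {X : Type*} [NormedAddCommGroup X] [NormedSpace ℂ X]
    (T : X →L[ℂ] X) (hfin : FiniteDimensional ℂ (LinearMap.range (T : X →ₗ[ℂ] X))) :
    ∃ (v : Fin (finrank ℂ (LinearMap.range (T : X →ₗ[ℂ] X))) → X)
      (μ : Fin (finrank ℂ (LinearMap.range (T : X →ₗ[ℂ] X))) → ℂ), LinearIndependent ℂ v ∧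
      (∀ j, T (v j) - μ j • v j ∈ Submodule.span ℂ (v '' Set.Iio j)) ∧
      ∀ z : ℂ, z ≠ 0 → {j | μ j = z}.encard =
        Cardinal.toENat (Module.rank ℂ (Module.End.maxGenEigenspace (T : X →ₗ[ℂ] X) z)) := by
  classical
  obtain ⟨v, μ, hv, hμ⟩ := exists_triangular_family _ rfl
    ((T : X →ₗ[ℂ] X).restrict fun x (_ : x ∈ LinearMap.range (T : X →ₗ[ℂ] X)) =>
      LinearMap.mem_range_self _ x)
  refine ⟨fun j => v j, μ, hv.map' (Submodule.subtype _) (Submodule.ker_subtype _), ?_, ?_⟩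
  · intro j
    have h := Submodule.mem_map_of_mem
      (f := (LinearMap.range (T : X →ₗ[ℂ] X)).subtype) (hμ j)
    rw [Submodule.map_span, ← Set.image_comp] at h
    exact h
  · intro z hz
    rw [rank_maxGenEigenspace_restrict_range _ hz, ← finrank_eq_rank, map_natCast,
      ← card_filter_eq_finrank_maxGenEigenspace rfl _ hv hμ z, ← Set.encard_coe_eq_coe_finsetCard]
    congr 1
    ext j
    simp

/-- Two families whose nonzero values occur equally often, one of them finite, have nonzero parts
that are rearrangements of each other. -/
theorem exists_equiv_of_encard_fiber_eq {α β γ : Type*} [Zero γ] [Finite β] {f : α → γ} {g : β → γ}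
    (h : ∀ z ≠ 0, {a | f a = z}.encard = {b | g b = z}.encard) :
    ∃ e : {a // f a ≠ 0} ≃ {b // g b ≠ 0}, ∀ a, g (e a) = f a := by
  have hfib : ∀ z : {z : γ // z ≠ 0}, Nonempty
      ({a : {a // f a ≠ 0} // (⟨f a, a.2⟩ : {z : γ // z ≠ 0}) = z} ≃
        {b : {b // g b ≠ 0} // (⟨g b, b.2⟩ : {z : γ // z ≠ 0}) = z}) := by
    rintro ⟨z, hz⟩
    have hb : {b | g b = z}.Finite := Set.toFinite _
    -- Finiteness has to be known before passing to natural-number cardinalities, and `α` may be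
    -- infinite.
    have ha : {a | f a = z}.Finite := by
      rw [← Set.encard_lt_top_iff, h z hz]
      exact hb.encard_lt_top
    have := ha.to_subtype
    have hc : Nat.card {a | f a = z} = Nat.card {b | g b = z} := by
      have := congrArg ENat.toNat (h z hz)
      simpa [Set.ncard_def, Nat.card_coe_set_eq] using this
    obtain ⟨e⟩ := Finite.card_eq.1 hc
    refine ⟨Equiv.trans ?_ (e.trans ?_)⟩
    · exact ⟨fun a => ⟨a.1.1, congrArg Subtype.val a.2⟩,
        fun a => ⟨⟨a.1, by rw [show f a.1 = z from a.2]; exact hz⟩,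
          Subtype.ext a.2⟩, fun _ => rfl, fun _ => rfl⟩
    · exact ⟨fun b => ⟨⟨b.1, by rw [show g b.1 = z from b.2]; exact hz⟩,
          Subtype.ext b.2⟩, fun b => ⟨b.1.1, congrArg Subtype.val b.2⟩,
          fun _ => rfl, fun _ => rfl⟩
  let e := fun z => (hfib z).some
  refine ⟨(Equiv.sigmaFiberEquiv fun a : {a // f a ≠ 0} => (⟨f a, a.2⟩ : {z : γ // z ≠ 0})).symm.trans
    ((Equiv.sigmaCongrRight e).trans
      (Equiv.sigmaFiberEquiv fun b : {b // g b ≠ 0} => (⟨g b, b.2⟩ : {z : γ // z ≠ 0}))), ?_⟩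
  intro a
  exact congrArg Subtype.val (e ⟨f a, a.2⟩ ⟨a, rfl⟩).2

theorem hasSum_norm_rpow_of_encard_fiber_eq {n : ℕ} {lam : ℕ → ℂ} {μ : Fin n → ℂ}
    (h : ∀ z ≠ 0, {k | lam k = z}.encard = {j | μ j = z}.encard) {p : ℝ} (hp : 0 < p) :
    HasSum (fun k => ‖lam k‖ ^ p) (∑ j, ‖μ j‖ ^ p) := by
  obtain ⟨e, he⟩ := exists_equiv_of_encard_fiber_eq h
  have hz : ∀ {z : ℂ}, ‖z‖ ^ p ≠ 0 → z ≠ 0 := fun hz h0 => hz (by simp [h0, hp.ne'])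
  rw [← hasSum_subtype_iff_of_support_subset (s := {k | lam k ≠ 0}) fun k hk => hz hk]
  have h1 : HasSum (fun j => ‖μ j‖ ^ p) (∑ j, ‖μ j‖ ^ p) := hasSum_fintype _
  rw [← hasSum_subtype_iff_of_support_subset (s := {j | μ j ≠ 0}) fun k hk => hz hk] at h1
  have h2 := e.hasSum_iff.2 h1
  have h3 : (fun k => ‖lam k‖ ^ p) ∘ ((↑) : {k | lam k ≠ 0} → ℕ) =
      ((fun k => ‖μ k‖ ^ p) ∘ ((↑) : {j | μ j ≠ 0} → Fin n)) ∘ e :=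
    funext fun a => congrArg (fun z : ℂ => ‖z‖ ^ p) (he a).symm
  rwa [h3]

/-! ### Gram-Schmidt norms as distances -/

/-- The Gram-Schmidt vector is the component of `f j` orthogonal to its predecessors, hence also
that of `f j + e`; Cauchy-Schwarz concludes. -/
theorem norm_gramSchmidt_le_norm_add {ι H : Type*} [LinearOrder ι] [LocallyFiniteOrderBot ι]
    [WellFoundedLT ι] [NormedAddCommGroup H] [InnerProductSpace ℂ H] (f : ι → H) (j : ι) {e : H}
    (he : e ∈ Submodule.span ℂ (f '' Set.Iio j)) :
    ‖InnerProductSpace.gramSchmidt ℂ f j‖ ≤ ‖f j + e‖ := by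
  set g := InnerProductSpace.gramSchmidt ℂ f with hg
  have horth : ∀ y ∈ Submodule.span ℂ (f '' Set.Iio j), inner ℂ (g j) y = 0 := by
    intro y hy
    induction hy using Submodule.span_induction with
    | mem y hy =>
      obtain ⟨i, hi, rfl⟩ := hy
      exact InnerProductSpace.gramSchmidt_inv_triangular ℂ f hi
    | zero => simp
    | add x y _ _ hx hy => rw [inner_add_right, hx, hy, add_zero]
    | smul c x _ hx => rw [inner_smul_right, hx, mul_zero]
  have hsub : f j - g j ∈ Submodule.span ℂ (f '' Set.Iio j) := by
    rw [← InnerProductSpace.span_gramSchmidt_Iio ℂ f j,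
      InnerProductSpace.gramSchmidt_def'' ℂ f j, add_sub_cancel_left]
    exact Submodule.sum_mem _ fun i hi => Submodule.smul_mem _ _ <|
      Submodule.subset_span ⟨i, Finset.mem_Iio.1 hi, rfl⟩
  have hin : inner ℂ (g j) (f j + e) = inner ℂ (g j) (g j) := by
    have h1 := horth _ hsub
    rw [inner_sub_right, sub_eq_zero] at h1
    rw [inner_add_right, horth e he, add_zero, h1]
  have hcs := norm_inner_le_norm (𝕜 := ℂ) (g j) (f j + e)
  rw [hin, inner_self_eq_norm_sq_to_K] at hcs
  simp only [norm_pow, Complex.coe_algebraMap, Complex.norm_real, norm_norm] at hcs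
  rcases (norm_nonneg (g j)).eq_or_lt with h | h
  · rw [← h]; positivity
  · nlinarith

/-- The correction subtracted by Gram-Schmidt lies in the image under `Φ` of the earlier span, so it
lifts even when `Φ` is not injective. -/
theorem exists_gramSchmidt_comp_eq {ι E H : Type*} [LinearOrder ι] [LocallyFiniteOrderBot ι]
    [WellFoundedLT ι] [AddCommGroup E] [Module ℂ E] [NormedAddCommGroup H] [InnerProductSpace ℂ H]
    (v : ι → E) (Φ : E →ₗ[ℂ] H) (j : ι) :
    ∃ e ∈ Submodule.span ℂ (v '' Set.Iio j),
      InnerProductSpace.gramSchmidt ℂ (Φ ∘ v) j = Φ (v j + e) := by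
  have hsub : InnerProductSpace.gramSchmidt ℂ (Φ ∘ v) j - Φ (v j) ∈
      (Submodule.span ℂ (v '' Set.Iio j)).map Φ := by
    rw [Submodule.map_span, ← Set.image_comp, ← InnerProductSpace.span_gramSchmidt_Iio ℂ (Φ ∘ v) j,
      ← Submodule.neg_mem_iff, neg_sub, ← Function.comp_apply (f := Φ),
      InnerProductSpace.gramSchmidt_def'' ℂ (Φ ∘ v) j, add_sub_cancel_left]
    exact Submodule.sum_mem _ fun i hi => Submodule.smul_mem _ _ <|
      Submodule.subset_span ⟨i, Finset.mem_Iio.1 hi, rfl⟩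
  obtain ⟨e, he, h⟩ := hsub
  exact ⟨e, he, by rw [map_add, h, add_sub_cancel]⟩

/-- A Gram-Schmidt orthonormalisation of `Φ ∘ v` lifts to a family whose image under any further
linear map `Ψ` controls the growth of the Gram-Schmidt norms. -/
theorem exists_orthonormal_lift {ι E H : Type*} [LinearOrder ι] [LocallyFiniteOrderBot ι]
    [WellFoundedLT ι] [AddCommGroup E] [Module ℂ E] [NormedAddCommGroup H] [InnerProductSpace ℂ H]
    (v : ι → E) (J : Finset ι) (Φ : E →ₗ[ℂ] H)
    (hΦ : ∀ j ∈ J, InnerProductSpace.gramSchmidt ℂ (Φ ∘ v) j ≠ 0) :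
    ∃ u : J → E, Orthonormal ℂ (fun j => Φ (u j)) ∧ ∀ (Ψ : E →ₗ[ℂ] H) (j : J),
      ‖InnerProductSpace.gramSchmidt ℂ (Ψ ∘ v) j‖ / ‖InnerProductSpace.gramSchmidt ℂ (Φ ∘ v) j‖ ≤
        ‖Ψ (u j)‖ := by
  choose e he hge using exists_gramSchmidt_comp_eq v Φ
  refine ⟨fun j => ((‖InnerProductSpace.gramSchmidt ℂ (Φ ∘ v) j‖ : ℂ)⁻¹) • (v j + e j), ?_, ?_⟩
  · have h : ∀ j : J, Φ (((‖InnerProductSpace.gramSchmidt ℂ (Φ ∘ v) j‖ : ℂ)⁻¹) • (v j + e j)) =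
        ((‖InnerProductSpace.gramSchmidt ℂ (Φ ∘ v) j‖ : ℂ)⁻¹) •
          InnerProductSpace.gramSchmidt ℂ (Φ ∘ v) j := fun j => by rw [map_smul, hge]
    simp only [h]
    refine ⟨fun j => norm_smul_inv_norm (𝕜 := ℂ) (hΦ j j.2), fun i j hij => ?_⟩
    beta_reduce
    rw [inner_smul_left, inner_smul_right,
      InnerProductSpace.gramSchmidt_orthogonal ℂ _ fun h => hij (Subtype.ext h), mul_zero, mul_zero]
  · intro Ψ j
    rw [map_smul, norm_smul, norm_inv, Complex.norm_real, norm_norm, div_eq_inv_mul, map_add]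
    refine mul_le_mul_of_nonneg_left (norm_gramSchmidt_le_norm_add (Ψ ∘ v) j ?_) (by positivity)
    rw [Set.image_comp, ← Submodule.map_span]
    exact Submodule.mem_map_of_mem (he j)

/-! ### Hölder and Jensen inequalities -/

/-- Hölder for several factors: weighted AM-GM after dividing by the bounds. These may vanish, so
they are enlarged by `ε`, which then tends to `0`. -/
theorem Finset.sum_prod_rpow_le_prod_rpow {ι κ : Type*} (I : Finset ι) (J : Finset κ) (w : ι → ℝ)
    (hw : ∀ i ∈ I, 0 ≤ w i) (hw1 : ∑ i ∈ I, w i = 1) (x : ι → κ → ℝ)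
    (hx : ∀ i ∈ I, ∀ j ∈ J, 0 ≤ x i j) (S : ι → ℝ) (hS : ∀ i ∈ I, ∑ j ∈ J, x i j ≤ S i) :
    ∑ j ∈ J, ∏ i ∈ I, x i j ^ w i ≤ ∏ i ∈ I, S i ^ w i := by
  have hS0 : ∀ i ∈ I, 0 ≤ S i := fun i hi => (Finset.sum_nonneg (hx i hi)).trans (hS i hi)
  have key : ∀ ε : ℝ, 0 < ε → ∑ j ∈ J, ∏ i ∈ I, x i j ^ w i ≤ ∏ i ∈ I, (S i + ε) ^ w i := by
    intro ε hε
    have hpos : ∀ i ∈ I, 0 < S i + ε := fun i hi => by linarith [hS0 i hi]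
    have h1 : ∀ j ∈ J, ∏ i ∈ I, x i j ^ w i ≤
        (∏ i ∈ I, (S i + ε) ^ w i) * ∑ i ∈ I, w i * (x i j / (S i + ε)) := by
      intro j hj
      have h := Real.geom_mean_le_arith_mean_weighted I w (fun i => x i j / (S i + ε)) hw hw1
        fun i hi => div_nonneg (hx i hi j hj) (hpos i hi).le
      refine le_trans (le_of_eq ?_) (mul_le_mul_of_nonneg_left h
        (Finset.prod_nonneg fun i hi => Real.rpow_nonneg (hpos i hi).le _))
      rw [← Finset.prod_mul_distrib]
      refine Finset.prod_congr rfl fun i hi => ?_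
      rw [← Real.mul_rpow (hpos i hi).le (div_nonneg (hx i hi j hj) (hpos i hi).le),
        mul_div_cancel₀ _ (hpos i hi).ne']
    refine (Finset.sum_le_sum h1).trans ?_
    rw [← Finset.mul_sum, Finset.sum_comm]
    refine mul_le_of_le_one_right
      (Finset.prod_nonneg fun i hi => Real.rpow_nonneg (hpos i hi).le _) ?_
    rw [← hw1]
    refine Finset.sum_le_sum fun i hi => ?_
    rw [← Finset.mul_sum, ← Finset.sum_div]
    refine mul_le_of_le_one_right (hw i hi) ((div_le_one (hpos i hi)).2 ?_)
    linarith [hS i hi]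
  have hcont : Continuous fun ε : ℝ => ∏ i ∈ I, (S i + ε) ^ w i :=
    continuous_finsetProd _ fun i hi =>
      (continuous_const.add continuous_id).rpow_const fun _ => Or.inr (hw i hi)
  have hlim := (hcont.tendsto 0).mono_left (nhdsWithin_le_nhds (s := Set.Ioi 0))
  simp only [add_zero] at hlim
  exact ge_of_tendsto hlim (Filter.eventually_mem_set.2 self_mem_nhdsWithin |>.mono fun ε hε => key ε hε)

/-- Jensen for the probability weights `W`: Bernoulli's inequality gives the tangent line of `x ^ r`
at the mean `m`, to be summed termwise. -/
theorem rpow_le_tsum_of_hasSum_weighted {W β : ℕ → ℝ} {m r : ℝ} (hW : ∀ l, 0 ≤ W l)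
    (hβ : ∀ l, 0 ≤ β l) (hW1 : HasSum W 1) (hm : HasSum (fun l => β l * W l) m) (hr : 1 ≤ r)
    (hs : Summable fun l => β l ^ r * W l) : m ^ r ≤ ∑' l, β l ^ r * W l := by
  have hm0 : 0 ≤ m := hm.nonneg fun l => mul_nonneg (hβ l) (hW l)
  rcases hm0.eq_or_lt with rfl | hmpos
  · rw [Real.zero_rpow (by linarith)]
    exact tsum_nonneg fun l => mul_nonneg (Real.rpow_nonneg (hβ l) _) (hW l)
  have h1 : HasSum (fun l => m ^ r * ((1 - r) * W l + r / m * (β l * W l))) (m ^ r) := by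
    have h := ((hW1.mul_left (1 - r)).add (hm.mul_left (r / m))).mul_left (m ^ r)
    rwa [div_mul_cancel₀ _ hmpos.ne', mul_one, sub_add_cancel, mul_one] at h
  refine hasSum_le (fun l => ?_) h1 hs.hasSum
  have h := one_add_mul_self_le_rpow_one_add (s := β l / m - 1)
    (by linarith [div_nonneg (hβ l) hm0]) hr
  rw [add_sub_cancel, Real.div_rpow (hβ l) hm0, le_div_iff₀ (by positivity)] at h
  calc m ^ r * ((1 - r) * W l + r / m * (β l * W l))
      = (1 + r * (β l / m - 1)) * m ^ r * W l := by ring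
    _ ≤ _ := mul_le_mul_of_nonneg_right h (hW l)

/-! ### Diagonal maps on ℓ² -/

/-- The Hilbert space of square summable sequences. -/
abbrev EllTwo : Type := lp (fun _ : ℕ => ℂ) 2

theorem EllTwo.hasSum_norm_sq (f : EllTwo) : HasSum (fun l => ‖f l‖ ^ 2) (‖f‖ ^ 2) := by
  have h := lp.hasSum_norm (p := 2) (by norm_num) f
  simpa using h

/-- Bessel's inequality for the `l`-th unit vector. -/
theorem EllTwo.sum_norm_apply_sq_le_one {ι : Type*} [Fintype ι] {f : ι → EllTwo}
    (hf : Orthonormal ℂ f) (l : ℕ) : ∑ j, ‖f j l‖ ^ 2 ≤ 1 := by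
  have h := hf.sum_inner_products_le (lp.single 2 l (1 : ℂ)) (s := Finset.univ)
  rw [lp.norm_single (by norm_num)] at h
  simpa [lp.inner_single_right] using h

theorem sum_norm_sq_le_of_bessel {ι : Type*} [Fintype ι] {c : ℕ → ℝ}
    (hs : Summable fun l => c l ^ 2) (y : ι → EllTwo) (z : ι → ℕ → ℂ)
    (hy : ∀ j l, y j l = c l * z j l) (hz : ∀ l, ∑ j, ‖z j l‖ ^ 2 ≤ 1) :
    ∑ j, ‖y j‖ ^ 2 ≤ ∑' l, c l ^ 2 := by
  refine hasSum_le (fun l => ?_) (hasSum_sum fun j _ => EllTwo.hasSum_norm_sq (y j)) hs.hasSum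
  simp only [hy, norm_mul, mul_pow, Complex.norm_real, Real.norm_eq_abs, sq_abs]
  rw [← Finset.mul_sum]
  exact mul_le_of_le_one_right (sq_nonneg _) (hz l)

/-- The array `‖f j l‖ ^ 2` sums to `1` over `l` and to at most `1` over `j`. Jensen with exponent
`p / 2 ≥ 1` uses the first fact, exchanging the sums the second. -/
theorem sum_norm_rpow_le_of_orthonormal {ι : Type*} [Fintype ι] {β : ℕ → ℝ} (hβ : ∀ l, 0 ≤ β l)
    {p : ℝ} (hp : 2 ≤ p) (hs : Summable fun l => β l ^ p) (f y : ι → EllTwo)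
    (hf : Orthonormal ℂ f) (hy : ∀ j l, y j l = β l * f j l) :
    ∑ j, ‖y j‖ ^ p ≤ ∑' l, β l ^ p := by
  have hpow : ∀ x : ℝ, 0 ≤ x → (x ^ 2) ^ (p / 2) = x ^ p := fun x hx => by
    rw [← Real.rpow_natCast, ← Real.rpow_mul hx]; congr 1; push_cast; ring
  have hle : ∀ j l, ‖f j l‖ ^ 2 ≤ 1 := fun j l =>
    (Finset.single_le_sum (f := fun j => ‖f j l‖ ^ 2) (fun _ _ => sq_nonneg _)
      (Finset.mem_univ j)).trans (EllTwo.sum_norm_apply_sq_le_one hf l)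
  have hsj : ∀ j, Summable fun l => β l ^ p * ‖f j l‖ ^ 2 := fun j =>
    hs.of_nonneg_of_le (fun l => mul_nonneg (Real.rpow_nonneg (hβ l) _) (sq_nonneg _))
      fun l => mul_le_of_le_one_right (Real.rpow_nonneg (hβ l) _) (hle j l)
  have h1 : ∀ j, ‖y j‖ ^ p ≤ ∑' l, β l ^ p * ‖f j l‖ ^ 2 := by
    intro j
    have hm : HasSum (fun l => β l ^ 2 * ‖f j l‖ ^ 2) (‖y j‖ ^ 2) := by
      have h := EllTwo.hasSum_norm_sq (y j)
      simpa only [hy, norm_mul, mul_pow, Complex.norm_real, Real.norm_eq_abs, sq_abs] using h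
    have hW := EllTwo.hasSum_norm_sq (f j)
    rw [hf.1 j, one_pow] at hW
    have h := rpow_le_tsum_of_hasSum_weighted (r := p / 2) (fun l => sq_nonneg ‖f j l‖)
      (fun l => sq_nonneg (β l)) hW hm (by linarith)
      (by simpa only [hpow _ (hβ _)] using hsj j)
    simpa only [hpow _ (hβ _), hpow _ (norm_nonneg _)] using h
  refine (Finset.sum_le_sum fun j _ => h1 j).trans ?_
  refine hasSum_le (fun l => ?_) (hasSum_sum fun j _ => (hsj j).hasSum) hs.hasSum
  rw [← Finset.mul_sum]
  exact mul_le_of_le_one_right (Real.rpow_nonneg (hβ l) _) (EllTwo.sum_norm_apply_sq_le_one hf l)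

theorem Summable.rpow_of_le {a : ℕ → ℝ} (ha : ∀ l, 0 ≤ a l) {s q : ℝ} (hs0 : 0 < s) (hsq : s ≤ q)
    (hs : Summable fun l => a l ^ s) : Summable fun l => a l ^ q := by
  refine Summable.of_norm_bounded_eventually_nat hs ?_
  filter_upwards [hs.tendsto_atTop_zero.eventually_lt_const one_pos] with l hl
  rw [Real.norm_of_nonneg (Real.rpow_nonneg (ha l) _)]
  refine Real.rpow_le_rpow_of_exponent_ge' (ha l) ?_ hs0.le hsq
  by_contra! h
  exact absurd hl (not_lt.2 (Real.one_le_rpow h.le hs0.le))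

theorem memℓp_two_of_bounded {c : ℕ → ℝ} (hc : Summable fun l => c l ^ 2) {z : ℕ → ℂ} {C : ℝ}
    (hz : ∀ l, ‖z l‖ ≤ C) : Memℓp (fun l => (c l : ℂ) * z l) 2 := by
  refine memℓp_gen ?_
  refine (hc.mul_right (C ^ 2)).of_nonneg_of_le (fun l => by positivity) fun l => ?_
  simp only [norm_mul, Complex.norm_real, Real.norm_eq_abs, ENNReal.toReal_ofNat, Real.rpow_ofNat,
    mul_pow, sq_abs]
  exact mul_le_mul_of_nonneg_left (pow_le_pow_left₀ (norm_nonneg _) (hz l) 2) (sq_nonneg _)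

/-- The linear map `u ↦ (cₗ φₗ(u))ₗ` into `ℓ²`. -/
def weightedMap {E : Type*} [AddCommGroup E] [Module ℂ E] (c : ℕ → ℂ) (φ : ℕ → E →ₗ[ℂ] ℂ)
    (h : ∀ u, Memℓp (fun l => c l * φ l u) 2) : E →ₗ[ℂ] EllTwo where
  toFun u := ⟨fun l => c l * φ l u, h u⟩
  map_add' u v := by
    refine lp.ext (funext fun l => ?_)
    change c l * φ l (u + v) = c l * φ l u + c l * φ l v
    rw [map_add, mul_add]
  map_smul' r u := by
    ext l
    simp [mul_left_comm]

/-! ### The ℓ_s bound for Gram-Schmidt ratios -/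

/-- Cuts the exponent `1 - s/2`, left after the Hilbert-Schmidt step, into `N` equal pieces; `w ≤
s/2` makes `s / w ≥ 2`, as the diagonal estimate requires. -/
theorem exists_nat_mul_eq {s : ℝ} (hs0 : 0 < s) (hs2 : s ≤ 2) :
    ∃ (N : ℕ) (w : ℝ), 0 < w ∧ w ≤ s / 2 ∧ N * w = 1 - s / 2 := by
  rcases hs2.eq_or_lt with rfl | hlt
  · exact ⟨0, 1, by norm_num⟩
  · have h1 : 0 < (1 - s / 2) / (s / 2) := div_pos (by linarith) (by linarith)
    have hN : (0 : ℝ) < ⌈(1 - s / 2) / (s / 2)⌉₊ := Nat.cast_pos.2 (Nat.ceil_pos.2 h1)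
    refine ⟨⌈(1 - s / 2) / (s / 2)⌉₊, (1 - s / 2) / ⌈(1 - s / 2) / (s / 2)⌉₊,
      div_pos (by linarith) hN, ?_, mul_div_cancel₀ _ hN.ne'⟩
    rw [div_le_iff₀ hN, mul_comm, ← div_le_iff₀ (by linarith)]
    exact Nat.le_ceil _

theorem gramSchmidt_comp_ne_zero {ι E H : Type*} [LinearOrder ι] [LocallyFiniteOrderBot ι]
    [WellFoundedLT ι] [AddCommGroup E] [Module ℂ E] [NormedAddCommGroup H] [InnerProductSpace ℂ H]
    {v : ι → E} {Φ : E →ₗ[ℂ] H} {j : ι}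
    (h : ∀ e ∈ Submodule.span ℂ (v '' Set.Iio j), Φ (v j + e) ≠ 0) :
    InnerProductSpace.gramSchmidt ℂ (Φ ∘ v) j ≠ 0 := by
  obtain ⟨e, he, hge⟩ := exists_gramSchmidt_comp_eq v Φ j
  rw [hge]
  exact h e he

/-- If `Ψ u = (aₗ φₗ(u))ₗ`, where the `φₗ` factor through `Φ` with norm at most `1`, the growth of
the Gram-Schmidt norms from `Φ ∘ v` to `Ψ ∘ v` is bounded in `ℓ_s` by `(aₗ)`. -/
theorem sum_gramSchmidt_ratio_rpow_le {E : Type*} [AddCommGroup E] [Module ℂ E] {n : ℕ}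
    (v : Fin n → E) (J : Finset (Fin n)) {a : ℕ → ℝ} (ha : ∀ l, 0 ≤ a l) {s : ℝ} (hs0 : 0 < s)
    (hs2 : s ≤ 2) (hs : Summable fun l => a l ^ s) (Φ Ψ : E →ₗ[ℂ] EllTwo) (φ : ℕ → E →ₗ[ℂ] ℂ)
    (hφ : ∀ l, ∃ z : EllTwo, ‖z‖ ≤ 1 ∧ ∀ u, φ l u = inner ℂ z (Φ u))
    (hΨ : ∀ u l, Ψ u l = a l * φ l u)
    (hΦ0 : ∀ j ∈ J, ∀ e ∈ Submodule.span ℂ (v '' Set.Iio j), Φ (v j + e) ≠ 0)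
    (hΨ0 : ∀ j ∈ J, ∀ e ∈ Submodule.span ℂ (v '' Set.Iio j), Ψ (v j + e) ≠ 0) :
    ∑ j ∈ J, (‖InnerProductSpace.gramSchmidt ℂ (Ψ ∘ v) j‖ /
      ‖InnerProductSpace.gramSchmidt ℂ (Φ ∘ v) j‖) ^ s ≤ ∑' l, a l ^ s := by
  obtain ⟨N, w, hw0, hws, hNw⟩ := exists_nat_mul_eq hs0 hs2
  have hφb : ∀ u l, ‖φ l u‖ ≤ ‖Φ u‖ := by
    intro u l
    obtain ⟨z, hz, h⟩ := hφ l
    rw [h]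
    exact (norm_inner_le_norm _ _).trans (mul_le_of_le_one_left (norm_nonneg _) hz)
  have hθ : ∀ i : ℕ, 0 < s / 2 + i * w := fun i => by positivity
  have hmem : ∀ (i : ℕ) u, Memℓp (fun l => ((a l ^ (s / 2 + i * w) : ℝ) : ℂ) * φ l u) 2 := by
    intro i u
    refine memℓp_two_of_bounded ?_ (hφb u)
    have h := hs.rpow_of_le ha hs0 (q := (s / 2 + i * w) * 2) (by nlinarith [hθ i, i.cast_nonneg (α := ℝ)])
    refine h.congr fun l => ?_
    rw [Real.rpow_mul (ha l), Real.rpow_ofNat]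
  -- Interpolating maps: `Θ 0` carries the power `s/2` of the coefficients, each step adds `w`, and
  -- `Θ N` is `Ψ`.
  let Θ : ℕ → E →ₗ[ℂ] EllTwo := fun i =>
    weightedMap (fun l => ((a l ^ (s / 2 + i * w) : ℝ) : ℂ)) φ (hmem i)
  have hΘapp : ∀ i u l, Θ i u l = ((a l ^ (s / 2 + i * w) : ℝ) : ℂ) * φ l u := fun i u l => rfl
  have hΘN : Θ N = Ψ := by
    refine LinearMap.ext fun u => lp.ext (funext fun l => ?_)
    rw [hΘapp, hΨ, hNw, add_sub_cancel, Real.rpow_one]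
  -- A positive power of `a l` vanishes only if `a l` does, so the kernel of `Θ i` lies in that of
  -- `Ψ`.
  have hΘ0 : ∀ i, ∀ j ∈ J, ∀ e ∈ Submodule.span ℂ (v '' Set.Iio j), Θ i (v j + e) ≠ 0 := by
    intro i j hj e he h0
    refine hΨ0 j hj e he (lp.ext (funext fun l => ?_))
    have h := congrArg (fun f : EllTwo => f l) h0
    simp only [hΘapp] at h
    rw [hΨ]
    rcases mul_eq_zero.1 h with h | h
    · rw [(Real.rpow_eq_zero (ha l) (hθ i).ne').1 (by exact_mod_cast h)]
      simp
    · simp [h]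
  let G : ℕ → Fin n → ℝ := fun i j => Nat.casesOn i
    ‖InnerProductSpace.gramSchmidt ℂ (Φ ∘ v) j‖
    fun i => ‖InnerProductSpace.gramSchmidt ℂ (Θ i ∘ v) j‖
  have hG0 : ∀ i j, 0 ≤ G i j := fun i j => by cases i <;> exact norm_nonneg _
  have hGne : ∀ i, ∀ j ∈ J, G i j ≠ 0 := fun i j hj => by
    cases i with
    | zero => exact norm_ne_zero_iff.2 (gramSchmidt_comp_ne_zero (hΦ0 j hj))
    | succ i => exact norm_ne_zero_iff.2 (gramSchmidt_comp_ne_zero (hΘ0 i j hj))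
  -- Hilbert-Schmidt step: Bessel for the orthonormal family `Φ (u j)` against the vectors `z`
  -- representing `φ l`.
  have hfirst : ∑ j ∈ J, (G 1 j / G 0 j) ^ (2 : ℝ) ≤ ∑' l, a l ^ s := by
    obtain ⟨u, hu, hle⟩ := exists_orthonormal_lift v J Φ
      fun j hj => gramSchmidt_comp_ne_zero (hΦ0 j hj)
    have hsq : ∀ l, (a l ^ (s / 2 + (0 : ℕ) * w)) ^ 2 = a l ^ s := fun l => by
      rw [← Real.rpow_ofNat, ← Real.rpow_mul (ha l)]
      congr 1
      push_cast
      ring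
    have h := sum_norm_sq_le_of_bessel (c := fun l => a l ^ (s / 2 + (0 : ℕ) * w))
      (hs.congr fun l => (hsq l).symm) (fun j => Θ 0 (u j)) (fun j l => φ l (u j))
      (fun j l => hΘapp 0 (u j) l) fun l => by
        obtain ⟨z, hz, hzφ⟩ := hφ l
        have hb := hu.sum_inner_products_le z (s := Finset.univ)
        refine le_trans (le_of_eq ?_) (hb.trans (pow_le_one₀ (norm_nonneg _) hz))
        exact Finset.sum_congr rfl fun j _ => by rw [hzφ, norm_inner_symm]
    simp only [hsq] at h
    refine le_trans ?_ h
    rw [← Finset.sum_coe_sort J]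
    refine Finset.sum_le_sum fun j _ => ?_
    rw [Real.rpow_ofNat]
    exact pow_le_pow_left₀ (div_nonneg (hG0 1 j) (hG0 0 j)) (hle (Θ 0) j) 2
  have hstep : ∀ i, ∑ j ∈ J, (G (i + 2) j / G (i + 1) j) ^ (s / w) ≤ ∑' l, a l ^ s := by
    intro i
    obtain ⟨u, hu, hle⟩ := exists_orthonormal_lift v J (Θ i)
      fun j hj => gramSchmidt_comp_ne_zero (hΘ0 i j hj)
    have hpow : ∀ l, (a l ^ w) ^ (s / w) = a l ^ s := fun l => by
      rw [← Real.rpow_mul (ha l), mul_div_cancel₀ _ hw0.ne']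
    have h := sum_norm_rpow_le_of_orthonormal (β := fun l => a l ^ w) (p := s / w)
      (fun l => Real.rpow_nonneg (ha l) _) ((le_div_iff₀ hw0).2 (by linarith))
      (hs.congr fun l => (hpow l).symm) (fun j => Θ i (u j)) (fun j => Θ (i + 1) (u j)) hu
      fun j l => by
        have hexp : s / 2 + ((i + 1 : ℕ) : ℝ) * w = w + (s / 2 + i * w) := by
          push_cast
          ring
        rw [hΘapp, hΘapp, hexp, ← mul_assoc, ← Complex.ofReal_mul,
          ← Real.rpow_add_of_nonneg (ha l) hw0.le (hθ i).le]
    simp only [hpow] at h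
    refine le_trans ?_ h
    rw [← Finset.sum_coe_sort J]
    exact Finset.sum_le_sum fun j _ => Real.rpow_le_rpow
      (div_nonneg (hG0 (i + 2) j) (hG0 (i + 1) j)) (hle (Θ (i + 1)) j) (div_nonneg hs0.le hw0.le)
  let p : ℕ → ℝ := fun i => Nat.casesOn i 2 fun _ => s / w
  have hp0 : ∀ i, 0 < p i := fun i => by
    cases i
    · exact two_pos
    · exact div_pos hs0 hw0
  -- The Hölder weights are `s/2` once and `w` taken `N` times.
  have hsum : ∑ i ∈ Finset.range (N + 1), s / p i = 1 := by
    rw [Finset.sum_range_succ']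
    change (∑ _i ∈ Finset.range N, s / (s / w)) + s / 2 = 1
    rw [Finset.sum_const, Finset.card_range, nsmul_eq_mul, div_div_cancel₀ hs0.ne', hNw]
    ring
  have hmain := Finset.sum_prod_rpow_le_prod_rpow (Finset.range (N + 1)) J (fun i => s / p i)
    (fun i _ => (div_pos hs0 (hp0 i)).le) hsum (fun i j => (G (i + 1) j / G i j) ^ p i)
    (fun i _ j _ => Real.rpow_nonneg (div_nonneg (hG0 (i + 1) j) (hG0 i j)) _)
    (fun _ => ∑' l, a l ^ s) fun i _ => by
      cases i with
      | zero => exact hfirst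
      | succ i => exact hstep i
  have hS0 : 0 ≤ ∑' l, a l ^ s := tsum_nonneg fun l => Real.rpow_nonneg (ha l) _
  rw [← Real.rpow_sum_of_nonneg hS0 fun i _ => (div_pos hs0 (hp0 i)).le, hsum,
    Real.rpow_one] at hmain
  refine le_trans (le_of_eq ?_) hmain
  refine Finset.sum_congr rfl fun j hj => ?_
  have h1 : ∀ i, ((G (i + 1) j / G i j) ^ p i) ^ (s / p i) = (G (i + 1) j / G i j) ^ s := by
    intro i
    rw [← Real.rpow_mul (div_nonneg (hG0 (i + 1) j) (hG0 i j)), mul_div_cancel₀ _ (hp0 i).ne']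
  simp only [h1]
  rw [Real.finsetProd_rpow _ _ fun i _ => div_nonneg (hG0 (i + 1) j) (hG0 i j)]
  have htel : ∀ M, ∏ i ∈ Finset.range M, G (i + 1) j / G i j = G M j / G 0 j := by
    intro M
    induction M with
    | zero => simp [div_self (hGne 0 j hj)]
    | succ M ih =>
      rw [Finset.prod_range_succ, ih, mul_comm, div_mul_div_cancel₀ (hGne M j hj)]
  rw [htel]
  change _ = (‖InnerProductSpace.gramSchmidt ℂ (Θ N ∘ v) j‖ / _) ^ s
  rw [hΘN]
  rfl

/-- Complex coefficients in `sum_gramSchmidt_ratio_rpow_le`. -/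
theorem sum_gramSchmidt_ratio_rpow_le_of_complex {E : Type*} [AddCommGroup E] [Module ℂ E] {n : ℕ}
    (v : Fin n → E) (J : Finset (Fin n)) {a : ℕ → ℂ} {s : ℝ} (hs0 : 0 < s)
    (hs2 : s ≤ 2) (hs : Summable fun l => ‖a l‖ ^ s) (Φ Ψ : E →ₗ[ℂ] EllTwo) (φ : ℕ → E →ₗ[ℂ] ℂ)
    (hφ : ∀ l, ∃ z : EllTwo, ‖z‖ ≤ 1 ∧ ∀ u, φ l u = inner ℂ z (Φ u))
    (hΨ : ∀ u l, Ψ u l = a l * φ l u)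
    (hΦ0 : ∀ j ∈ J, ∀ e ∈ Submodule.span ℂ (v '' Set.Iio j), Φ (v j + e) ≠ 0)
    (hΨ0 : ∀ j ∈ J, ∀ e ∈ Submodule.span ℂ (v '' Set.Iio j), Ψ (v j + e) ≠ 0) :
    ∑ j ∈ J, (‖InnerProductSpace.gramSchmidt ℂ (Ψ ∘ v) j‖ /
      ‖InnerProductSpace.gramSchmidt ℂ (Φ ∘ v) j‖) ^ s ≤ ∑' l, ‖a l‖ ^ s := by
  -- The phases of `a l` are absorbed into `φ l`; where `a l = 0` the quotient is `0`, which is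
  -- harmless.
  refine sum_gramSchmidt_ratio_rpow_le v J (fun l => norm_nonneg (a l)) hs0 hs2 hs Φ Ψ
    (fun l => (a l / ‖a l‖) • φ l) (fun l => ?_) (fun u l => ?_) hΦ0 hΨ0
  · obtain ⟨z, hz, h⟩ := hφ l
    refine ⟨(starRingEnd ℂ) (a l / ‖a l‖) • z, ?_, fun u => ?_⟩
    · rw [norm_smul, RCLike.norm_conj, norm_div, Complex.norm_real, norm_norm]
      exact mul_le_one₀ (div_self_le_one _) (norm_nonneg _) hz
    · rw [inner_smul_left, Complex.conj_conj, LinearMap.smul_apply, h, smul_eq_mul]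
  · rw [hΨ, LinearMap.smul_apply, smul_eq_mul, ← mul_assoc]
    congr 1
    rcases eq_or_ne (a l) 0 with h | h
    · simp [h]
    · rw [mul_div_cancel₀ _ (Complex.ofReal_ne_zero.2 (norm_ne_zero_iff.2 h))]

/-! ### Factorization of nuclear operators through ℓ² -/

theorem exists_ellTwo_of_weakTwoNorm_le_one {Y : Type*} [NormedAddCommGroup Y] [NormedSpace ℂ Y]
    {y : ℕ → Y} (hy : weakTwoNorm y ≤ 1) (y' : StrongDual ℂ Y) (hy' : ‖y'‖ ≤ 1) :
    ∃ z : EllTwo, ‖z‖ ≤ 1 ∧ ∀ l, z l = (starRingEnd ℂ) (y' (y l)) := by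
  have h1 : (∑' n, ‖y' (y n)‖ₑ ^ 2) ^ (1 / 2 : ℝ) ≤ 1 :=
    (le_iSup₂ (f := fun (y' : StrongDual ℂ Y) (_ : ‖y'‖ ≤ 1) =>
      (∑' n, ‖y' (y n)‖ₑ ^ 2) ^ (1 / 2 : ℝ)) y' hy').trans hy
  have h2 : ∑' n, ‖y' (y n)‖ₑ ^ 2 ≤ 1 := by
    by_contra! h
    exact absurd h1 (not_le.2 (ENNReal.one_lt_rpow h (by norm_num)))
  have h3 : ∀ n, ‖y' (y n)‖ₑ ^ 2 = ENNReal.ofReal (‖y' (y n)‖ ^ 2) := fun n => by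
    rw [ENNReal.ofReal_pow (norm_nonneg _), ofReal_norm]
  simp only [h3] at h2
  have hs : Summable fun n => ‖y' (y n)‖ ^ 2 := by
    have h := ENNReal.summable_toReal (ne_top_of_le_ne_top ENNReal.one_ne_top h2)
    exact h.congr fun n => ENNReal.toReal_ofReal (sq_nonneg _)
  have hmem : Memℓp (fun l => (starRingEnd ℂ) (y' (y l))) 2 := memℓp_gen (by simpa using hs)
  refine ⟨⟨_, hmem⟩, ?_, fun l => rfl⟩
  rw [← ENNReal.ofReal_tsum_of_nonneg (fun _ => sq_nonneg _) hs, ENNReal.ofReal_le_one] at h2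
  have h4 := (EllTwo.hasSum_norm_sq ⟨_, hmem⟩).tsum_eq
  simp only [RCLike.norm_conj] at h4
  exact (sq_le_one_iff₀ (norm_nonneg _)).1 (h4.symm.le.trans h2)

/-- A `(s;2)`-nuclear operator factors through `ℓ²`. -/
theorem IsTwoNuclearRep.exists_factorization {E X Y : Type*} [AddCommGroup E] [Module ℂ E]
    [NormedAddCommGroup X] [NormedSpace ℂ X] [NormedAddCommGroup Y] [NormedSpace ℂ Y] {s : ℝ}
    (hs0 : 0 < s) (hs2 : s ≤ 2) {T : X →L[ℂ] Y} {a : ℕ → ℂ} {x' : ℕ → StrongDual ℂ X} {y : ℕ → Y}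
    (h : IsTwoNuclearRep s T a x' y) (hy : weakTwoNorm y ≤ 1) (Q : E →ₗ[ℂ] X) :
    ∃ Ψ : E →ₗ[ℂ] EllTwo, (∀ u l, Ψ u l = a l * x' l (Q u)) ∧ (∀ u, Ψ u = 0 → T (Q u) = 0) ∧
      ∀ y' : StrongDual ℂ Y, ‖y'‖ ≤ 1 →
        ∃ z : EllTwo, ‖z‖ ≤ 1 ∧ ∀ u, y' (T (Q u)) = inner ℂ z (Ψ u) := by
  have ha : Summable fun l => ‖a l‖ ^ 2 := by
    simpa using h.summable.rpow_of_le (fun l => norm_nonneg (a l)) hs0 hs2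
  have hmem : ∀ u, Memℓp (fun l => a l * x' l (Q u)) 2 := by
    intro u
    have h1 := memℓp_two_of_bounded ha (z := fun l => x' l (Q u)) (C := ‖Q u‖) fun l =>
      ((x' l).le_opNorm _).trans (mul_le_of_le_one_left (norm_nonneg _) (h.norm_le_one l))
    refine memℓp_gen ((h1.summable (by norm_num)).congr fun l => ?_)
    simp
  let Ψ : E →ₗ[ℂ] EllTwo := weightedMap a (fun l => (x' l : X →ₗ[ℂ] ℂ).comp Q) hmem
  have hΨ : ∀ u l, Ψ u l = a l * x' l (Q u) := fun u l => rfl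
  refine ⟨Ψ, hΨ, fun u hu => ?_, fun y' hy' => ?_⟩
  · refine (h.hasSum (Q u)).unique ?_
    have h0 : ∀ l, a l * x' l (Q u) = 0 := fun l => by
      rw [← hΨ, hu]
      rfl
    simp only [h0, zero_smul]
    exact hasSum_zero
  · obtain ⟨z, hz, hzl⟩ := exists_ellTwo_of_weakTwoNorm_le_one hy y' hy'
    refine ⟨z, hz, fun u => ?_⟩
    have h1 := y'.hasSum (h.hasSum (Q u))
    have h2 := lp.hasSum_inner (𝕜 := ℂ) z (Ψ u)
    refine h1.unique ?_
    convert h2 using 2 with l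
    rw [hΨ, hzl, map_smul, smul_eq_mul, RCLike.inner_apply, Complex.conj_conj]

/-! ### The cycle of factorizations and the eigenvalue bound -/

theorem operatorProduct_succ {m : ℕ} (X : Fin (m + 1) → Type*) [∀ i, NormedAddCommGroup (X i)]
    [∀ i, NormedSpace ℂ (X i)] (T : ∀ k : Fin m, X k.castSucc →L[ℂ] X k.succ) (k : Fin m) :
    operatorProduct X T k.succ = (T k).comp (operatorProduct X T k.castSucc) := rfl

theorem operatorProduct_last_eq_zero {m : ℕ} (X : Fin (m + 1) → Type*)
    [∀ i, NormedAddCommGroup (X i)] [∀ i, NormedSpace ℂ (X i)]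
    (T : ∀ k : Fin m, X k.castSucc →L[ℂ] X k.succ) (x : X 0) (j : Fin (m + 1)) :
    operatorProduct X T j x = 0 → operatorProduct X T (Fin.last m) x = 0 := by
  induction j using Fin.reverseInduction with
  | last => exact id
  | cast k ih =>
    intro h
    refine ih ?_
    rw [operatorProduct_succ, ContinuousLinearMap.comp_apply, h, map_zero]

theorem map_mem_span_of_triangular {K V ι : Type*} [Field K] [AddCommGroup V] [Module K V]
    [Preorder ι] {f : V →ₗ[K] V} {v : ι → V} {μ : ι → K}
    (hμ : ∀ j, f (v j) - μ j • v j ∈ Submodule.span K (v '' Set.Iio j)) {j : ι} {e : V}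
    (he : e ∈ Submodule.span K (v '' Set.Iio j)) : f e ∈ Submodule.span K (v '' Set.Iio j) := by
  induction he using Submodule.span_induction with
  | mem y hy =>
    obtain ⟨i, hi, rfl⟩ := hy
    rw [← sub_add_cancel (f (v i)) (μ i • v i)]
    exact Submodule.add_mem _
      (Submodule.span_mono (Set.image_mono (Set.Iio_subset_Iio (le_of_lt hi))) (hμ i))
      (Submodule.smul_mem _ _ (Submodule.subset_span ⟨i, hi, rfl⟩))
  | zero => rw [map_zero]; exact Submodule.zero_mem _
  | add x y _ _ hx hy => rw [map_add]; exact Submodule.add_mem _ hx hy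
  | smul c x _ hx => rw [map_smul]; exact Submodule.smul_mem _ _ hx

theorem exists_map_add_eq_smul_add {K V ι : Type*} [Field K] [AddCommGroup V] [Module K V]
    [Preorder ι] {f : V →ₗ[K] V} {v : ι → V} {μ : ι → K}
    (hμ : ∀ j, f (v j) - μ j • v j ∈ Submodule.span K (v '' Set.Iio j)) {j : ι} (hj : μ j ≠ 0)
    {e : V} (he : e ∈ Submodule.span K (v '' Set.Iio j)) :
    ∃ e' ∈ Submodule.span K (v '' Set.Iio j), f (v j + e) = μ j • (v j + e') := by
  refine ⟨(μ j)⁻¹ • (f (v j) - μ j • v j + f e), Submodule.smul_mem _ _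
    (Submodule.add_mem _ (hμ j) (map_mem_span_of_triangular hμ he)), ?_⟩
  rw [smul_add, smul_smul, mul_inv_cancel₀ hj, one_smul, map_add]
  abel

/-- Modulo earlier basis vectors `f` multiplies `v j` by `μ j`, so distances to the earlier span
scale by at least `‖μ j‖`. -/
theorem norm_mul_norm_gramSchmidt_le {ι E H : Type*} [LinearOrder ι] [LocallyFiniteOrderBot ι]
    [WellFoundedLT ι] [AddCommGroup E] [Module ℂ E] [NormedAddCommGroup H] [InnerProductSpace ℂ H]
    {f : E →ₗ[ℂ] E} {v : ι → E} {μ : ι → ℂ}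
    (hμ : ∀ j, f (v j) - μ j • v j ∈ Submodule.span ℂ (v '' Set.Iio j)) (Φ : E →ₗ[ℂ] H) {j : ι}
    (hj : μ j ≠ 0) : ‖μ j‖ * ‖InnerProductSpace.gramSchmidt ℂ (Φ ∘ v) j‖ ≤
      ‖InnerProductSpace.gramSchmidt ℂ (Φ.comp f ∘ v) j‖ := by
  obtain ⟨e, he, hge⟩ := exists_gramSchmidt_comp_eq v (Φ.comp f) j
  obtain ⟨e', he', h⟩ := exists_map_add_eq_smul_add hμ hj he
  rw [hge, LinearMap.comp_apply, h, map_smul, norm_smul, map_add]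
  refine mul_le_mul_of_nonneg_left (norm_gramSchmidt_le_norm_add (Φ ∘ v) j ?_) (norm_nonneg _)
  rw [Set.image_comp, ← Submodule.map_span]
  exact Submodule.mem_map_of_mem he'

theorem sum_norm_rpow_le_of_reps {m : ℕ}
    (X : Fin (m + 1 + 1) → Type*) [∀ i, NormedAddCommGroup (X i)] [∀ i, NormedSpace ℂ (X i)]
    (e : X (Fin.last (m + 1)) ≃ₗᵢ[ℂ] X 0)
    (s : Fin (m + 1) → ℝ) (hs : ∀ k, 0 < s k ∧ s k ≤ 2)
    (Tk : ∀ k : Fin (m + 1), X k.castSucc →L[ℂ] X k.succ) (T : X 0 →L[ℂ] X 0)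
    (hT : T = (e : X (Fin.last (m + 1)) →L[ℂ] X 0).comp (operatorProduct X Tk (Fin.last (m + 1))))
    (a : Fin (m + 1) → ℕ → ℂ) (x' : ∀ k : Fin (m + 1), ℕ → StrongDual ℂ (X k.castSucc))
    (y : ∀ k : Fin (m + 1), ℕ → X k.succ)
    (hrep : ∀ k, IsTwoNuclearRep (s k) (Tk k) (a k) (x' k) (y k))
    (hy : ∀ k, weakTwoNorm (y k) ≤ 1)
    {n : ℕ} {v : Fin n → X 0} {μ : Fin n → ℂ} (hv : LinearIndependent ℂ v)
    (hμ : ∀ j, T (v j) - μ j • v j ∈ Submodule.span ℂ (v '' Set.Iio j))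
    {st : ℝ} (hst0 : 0 < st) (hst : 1 / st = ∑ k, 1 / s k) :
    ∑ j, ‖μ j‖ ^ st ≤ (∏ k, lpQuasiNorm (s k) (a k)) ^ st := by
  classical
  have hμ' : ∀ j, (T : X 0 →ₗ[ℂ] X 0) (v j) - μ j • v j ∈ Submodule.span ℂ (v '' Set.Iio j) := hμ
  choose Ξ hΞ hΞ0 hΞR using fun k => (hrep k).exists_factorization (hs k).1 (hs k).2 (hy k)
    ((operatorProduct X Tk k.castSucc).comp T : X 0 →ₗ[ℂ] X k.castSucc)
  obtain ⟨Ψ0, hΨ0, hΨ00, hΨ0R⟩ := (hrep (Fin.last m)).exists_factorization (hs _).1 (hs _).2 (hy _)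
    (operatorProduct X Tk (Fin.last m).castSucc : X 0 →ₗ[ℂ] X (Fin.last m).castSucc)
  -- `Ψ 0` uses the last nuclear operator without a preceding `T`; the others come one full turn
  -- later. This closes the cycle: functionals on `X 0` applied to `T u` are controlled by `Ψ 0 u`.
  let Ψ : Fin (m + 1 + 1) → X 0 →ₗ[ℂ] EllTwo := Fin.cons Ψ0 Ξ
  have hTlast : ∀ x, T x = e (Tk (Fin.last m) (operatorProduct X Tk (Fin.last m).castSucc x)) :=
    fun x => by
      rw [hT]
      rfl
  have hR : ∀ (j : Fin (m + 1 + 1)) (y' : StrongDual ℂ (X j)), ‖y'‖ ≤ 1 →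
      ∃ z : EllTwo, ‖z‖ ≤ 1 ∧ ∀ u, y' (operatorProduct X Tk j (T u)) = inner ℂ z (Ψ j u) := by
    intro j
    induction j using Fin.cases with
    | zero =>
      intro y' hy'
      obtain ⟨z, hz, h⟩ := hΨ0R (y'.comp (e : X (Fin.last (m + 1)) →L[ℂ] X 0)) <| by
        refine (ContinuousLinearMap.opNorm_comp_le _ _).trans
          (mul_le_one₀ hy' (norm_nonneg _) ?_)
        exact e.toLinearIsometry.norm_toContinuousLinearMap_le
      refine ⟨z, hz, fun u => ?_⟩
      exact (congrArg y' (hTlast u)).trans (h u)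
    | succ k => exact hΞR k
  have hker : ∀ j x, Ψ j x = 0 → T (T x) = 0 := by
    intro j x
    induction j using Fin.cases with
    | zero =>
      intro h
      have h1 : T x = 0 := by
        rw [hTlast]
        exact (congrArg e (hΨ00 x h)).trans (map_zero e)
      rw [h1, map_zero]
    | succ k =>
      intro h
      have h1 := operatorProduct_last_eq_zero X Tk (T x) k.succ (hΞ0 k x h)
      conv_lhs => rw [hT]
      rw [ContinuousLinearMap.comp_apply, ← hT, h1, map_zero]
  let J : Finset (Fin n) := Finset.univ.filter fun j => μ j ≠ 0
  have hJ : ∀ j ∈ J, μ j ≠ 0 := fun j hj => (Finset.mem_filter.1 hj).2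
  -- If `Ψ i` killed `v j + e`, so would `T²`; but `T²` maps it to `μ j ^ 2` times a vector `v j +
  -- e₂`, nonzero by independence.
  have hne : ∀ i, ∀ j ∈ J, ∀ e ∈ Submodule.span ℂ (v '' Set.Iio j), Ψ i (v j + e) ≠ 0 := by
    intro i j hj e he h0
    have h := hker i _ h0
    obtain ⟨e₁, he₁, h₁⟩ := exists_map_add_eq_smul_add hμ' (hJ j hj) he
    obtain ⟨e₂, he₂, h₂⟩ := exists_map_add_eq_smul_add hμ' (hJ j hj) he₁
    rw [ContinuousLinearMap.coe_coe] at h₁ h₂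
    rw [h₁, map_smul, h₂, smul_eq_zero_iff_right (hJ j hj), smul_eq_zero_iff_right (hJ j hj)] at h
    refine hv.notMem_span_image (s := Set.Iio j) (x := j) (lt_irrefl j) ?_
    rw [eq_neg_of_add_eq_zero_left h]
    exact Submodule.neg_mem _ he₂
  let G : Fin (m + 1 + 1) → Fin n → ℝ := fun i j => ‖InnerProductSpace.gramSchmidt ℂ (Ψ i ∘ v) j‖
  have hGpos : ∀ i, ∀ j ∈ J, 0 < G i j := fun i j hj =>
    norm_pos_iff.2 (gramSchmidt_comp_ne_zero (hne i j hj))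
  have hratio : ∀ k : Fin (m + 1), ∑ j ∈ J, (G k.succ j / G k.castSucc j) ^ s k ≤
      ∑' l, ‖a k l‖ ^ s k := by
    intro k
    exact sum_gramSchmidt_ratio_rpow_le_of_complex v J (hs k).1 (hs k).2 (hrep k).summable
      (Ψ k.castSucc) (Ψ k.succ)
      (fun l => (x' k l : X k.castSucc →ₗ[ℂ] ℂ).comp
        ((operatorProduct X Tk k.castSucc).comp T : X 0 →ₗ[ℂ] X k.castSucc))
      (fun l => hR k.castSucc (x' k l) ((hrep k).norm_le_one l))
      (fun u l => hΞ k u l) (hne _) (hne _)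
  have hlast : Ψ (Fin.last (m + 1)) = Ψ0.comp (T : X 0 →ₗ[ℂ] X 0) := by
    refine LinearMap.ext fun u => lp.ext (funext fun l => ?_)
    exact (hΞ (Fin.last m) u l).trans (hΨ0 (T u) l).symm
  have hμle : ∀ j ∈ J, ‖μ j‖ ≤ ∏ k : Fin (m + 1), G k.succ j / G k.castSucc j := by
    intro j hj
    have h1 := Fin.prod_univ_succ fun i => G i j
    rw [Fin.prod_univ_castSucc] at h1
    have h2 : 0 < ∏ k : Fin (m + 1), G k.castSucc j := Finset.prod_pos fun k _ => hGpos _ j hj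
    rw [Finset.prod_div_distrib, le_div_iff₀ h2]
    have h3 : ‖μ j‖ * G 0 j ≤ G (Fin.last (m + 1)) j := by
      have h := norm_mul_norm_gramSchmidt_le hμ' Ψ0 (hJ j hj)
      rw [← hlast] at h
      exact h
    refine le_of_mul_le_mul_left ?_ (hGpos 0 j hj)
    rw [← h1, ← mul_assoc, mul_comm (G 0 j), mul_comm]
    exact mul_le_mul_of_nonneg_left h3 h2.le
  have hw1 : ∑ k, st / s k = 1 := by
    have h : ∑ k, st / s k = st * ∑ k, 1 / s k := by
      rw [Finset.mul_sum]
      exact Finset.sum_congr rfl fun k _ => by rw [mul_one_div]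
    rw [h, ← hst, mul_one_div_cancel hst0.ne']
  have hmain := Finset.sum_prod_rpow_le_prod_rpow Finset.univ J (fun k => st / s k)
    (fun k _ => (div_pos hst0 (hs k).1).le) hw1
    (fun k j => (G k.succ j / G k.castSucc j) ^ s k)
    (fun k _ j hj => Real.rpow_nonneg (div_pos (hGpos _ j hj) (hGpos _ j hj)).le _)
    (fun k => ∑' l, ‖a k l‖ ^ s k) fun k _ => hratio k
  have hS0 : ∀ k, 0 ≤ ∑' l, ‖a k l‖ ^ s k := fun k =>
    tsum_nonneg fun l => Real.rpow_nonneg (norm_nonneg _) _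
  have hrhs : ∏ k, (∑' l, ‖a k l‖ ^ s k) ^ (st / s k) = (∏ k, lpQuasiNorm (s k) (a k)) ^ st := by
    rw [← Real.finsetProd_rpow Finset.univ (fun k => lpQuasiNorm (s k) (a k))
      fun k _ => Real.rpow_nonneg (hS0 k) _]
    refine Finset.prod_congr rfl fun k _ => ?_
    rw [lpQuasiNorm, ← Real.rpow_mul (hS0 k), one_div_mul_eq_div]
  rw [hrhs] at hmain
  have hsum : ∑ j, ‖μ j‖ ^ st = ∑ j ∈ J, ‖μ j‖ ^ st := by
    refine (Finset.sum_subset (Finset.subset_univ J) fun j _ hj => ?_).symm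
    have : μ j = 0 := by simpa [J] using hj
    rw [this, norm_zero, Real.zero_rpow hst0.ne']
  rw [hsum]
  refine (Finset.sum_le_sum fun j hj => ?_).trans hmain
  refine (Real.rpow_le_rpow (norm_nonneg _) (hμle j hj) hst0.le).trans (le_of_eq ?_)
  rw [← Real.finsetProd_rpow _ _ fun k _ => (div_pos (hGpos _ j hj) (hGpos _ j hj)).le]
  refine Finset.prod_congr rfl fun k _ => ?_
  rw [← Real.rpow_mul (div_pos (hGpos _ j hj) (hGpos _ j hj)).le, mul_div_cancel₀ _ (hs k).1.ne']

/-! ### Normalised representations, infima and the change of exponent -/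

theorem weakTwoNorm_smul_le {Y : Type*} [NormedAddCommGroup Y] [NormedSpace ℂ Y] (c : ℂ)
    (y : ℕ → Y) : weakTwoNorm (fun n => c • y n) ≤ ‖c‖ₑ * weakTwoNorm y := by
  refine iSup₂_le fun y' hy' => ?_
  have h : (∑' n, ‖y' (c • y n)‖ₑ ^ 2) ^ (1 / 2 : ℝ) =
      ‖c‖ₑ * (∑' n, ‖y' (y n)‖ₑ ^ 2) ^ (1 / 2 : ℝ) := by
    simp only [map_smul, smul_eq_mul, enorm_mul, mul_pow]
    rw [ENNReal.tsum_mul_left, ENNReal.mul_rpow_of_nonneg _ _ (by norm_num), ← ENNReal.rpow_natCast,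
      ← ENNReal.rpow_mul]
    norm_num
  rw [h]
  exact mul_le_mul_right (le_iSup₂ (f := fun (y' : StrongDual ℂ Y) (_ : ‖y'‖ ≤ 1) =>
      (∑' n, ‖y' (y n)‖ₑ ^ 2) ^ (1 / 2 : ℝ)) y' hy') _

theorem IsTwoNuclear.exists_normalized {X Y : Type*} [NormedAddCommGroup X] [NormedSpace ℂ X]
    [NormedAddCommGroup Y] [NormedSpace ℂ Y] {s : ℝ} {T : X →L[ℂ] Y} (h : IsTwoNuclear s T) :
    ∃ a x' y, IsTwoNuclearRep s T a x' y ∧ weakTwoNorm y ≤ 1 := by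
  obtain ⟨a, x', y, h⟩ := h
  -- Adding `1` keeps `W` invertible when the weak norm is zero.
  set W : ℝ := (weakTwoNorm y).toReal + 1 with hW
  have hWpos : 0 < W := by positivity
  have hWC : (W : ℂ) ≠ 0 := Complex.ofReal_ne_zero.2 hWpos.ne'
  have hle : weakTwoNorm (fun n => (W : ℂ)⁻¹ • y n) ≤ 1 := by
    refine (weakTwoNorm_smul_le _ _).trans ?_
    rw [← ENNReal.ofReal_toReal h.weak_lt_top.ne, ← ofReal_norm, ← ENNReal.ofReal_mul (norm_nonneg _),
      ENNReal.ofReal_le_one, norm_inv, Complex.norm_real, Real.norm_of_nonneg hWpos.le,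
      inv_mul_le_one₀ hWpos, hW]
    linarith
  refine ⟨fun n => W * a n, x', fun n => (W : ℂ)⁻¹ • y n, ⟨h.norm_le_one, ?_, ?_, ?_⟩, hle⟩
  · simp only [norm_mul, Real.mul_rpow (norm_nonneg _) (norm_nonneg _)]
    exact h.summable.mul_left _
  · exact hle.trans_lt ENNReal.one_lt_top
  · intro x
    convert h.hasSum x using 2 with n
    rw [smul_smul]
    congr 1
    field_simp

theorem lpQuasiNorm_nonneg (p : ℝ) (a : ℕ → ℂ) : 0 ≤ lpQuasiNorm p a :=
  Real.rpow_nonneg (tsum_nonneg fun _ => Real.rpow_nonneg (norm_nonneg _) _) _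

theorem le_prod_sInf {ι : Type*} [Fintype ι] {L : ℝ} {S : ι → Set ℝ} (hne : ∀ k, (S k).Nonempty)
    (hS : ∀ k, ∀ c ∈ S k, 0 ≤ c) (h : ∀ c : ι → ℝ, (∀ k, c k ∈ S k) → L ≤ ∏ k, c k) :
    L ≤ ∏ k, sInf (S k) := by
  have key : ∀ ε : ℝ, 0 < ε → L ≤ ∏ k, (sInf (S k) + ε) := by
    intro ε hε
    choose c hc hlt using fun k => exists_lt_of_csInf_lt (hne k) (lt_add_of_pos_right (sInf (S k)) hε)
    exact (h c hc).trans (Finset.prod_le_prod (fun k _ => hS k _ (hc k)) fun k _ => (hlt k).le)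
  have hcont : Continuous fun ε : ℝ => ∏ k, (sInf (S k) + ε) :=
    continuous_finsetProd _ fun k _ => continuous_const.add continuous_id
  have hlim := (hcont.tendsto 0).mono_left (nhdsWithin_le_nhds (s := Set.Ioi 0))
  simp only [add_zero] at hlim
  exact ge_of_tendsto hlim
    ((Filter.eventually_mem_set.2 self_mem_nhdsWithin).mono fun ε hε => key ε hε)

/-- Hölder against the constant sequence `1`, with weights `1 - t/r` and `t/r`. -/
theorem rpow_sum_rpow_le_card_mul {ι : Type*} [Fintype ι] {x : ι → ℝ} (hx : ∀ j, 0 ≤ x j)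
    {t r : ℝ} (ht : 0 < t) (htr : t ≤ r) :
    (∑ j, x j ^ t) ^ (1 / t) ≤
      (Fintype.card ι : ℝ) ^ (1 / t - 1 / r) * (∑ j, x j ^ r) ^ (1 / r) := by
  have hr : 0 < r := ht.trans_le htr
  have h := Finset.sum_prod_rpow_le_prod_rpow (Finset.univ : Finset (Fin 2)) Finset.univ
    ![1 - t / r, t / r] (fun i _ => by
      fin_cases i
      · exact sub_nonneg.2 ((div_le_one hr).2 htr)
      · exact (div_pos ht hr).le) (by simp) (fun i j => ![1, x j ^ r] i) (fun i _ j _ => by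
      fin_cases i
      · exact zero_le_one
      · exact Real.rpow_nonneg (hx j) _) ![(Fintype.card ι : ℝ), ∑ j, x j ^ r] (fun i _ => by
      fin_cases i <;> simp)
  simp only [Fin.prod_univ_two, Matrix.cons_val_zero, Matrix.cons_val_one, Real.one_rpow,
    one_mul, ← Real.rpow_mul (hx _), mul_div_cancel₀ _ hr.ne'] at h
  have hsum : 0 ≤ ∑ j, x j ^ r := Finset.sum_nonneg fun j _ => Real.rpow_nonneg (hx j) _
  refine (Real.rpow_le_rpow (Finset.sum_nonneg fun j _ => Real.rpow_nonneg (hx j) _) h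
    (one_div_pos.2 ht).le).trans (le_of_eq ?_)
  rw [Real.mul_rpow (Real.rpow_nonneg (Nat.cast_nonneg _) _) (Real.rpow_nonneg hsum _),
    ← Real.rpow_mul (Nat.cast_nonneg _), ← Real.rpow_mul hsum]
  congr 2 <;> field_simp

end

theorem mainTheorem9 {m : ℕ} (hm : 0 < m)
    (X : Fin (m + 1) → Type*) [∀ i, NormedAddCommGroup (X i)] [∀ i, NormedSpace ℂ (X i)]
    [∀ i, CompleteSpace (X i)]
    -- the last space is (isometrically identified with) the first one
    (e : X (Fin.last m) ≃ₗᵢ[ℂ] X 0)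
    (s : Fin m → ℝ) (hs : ∀ k, 0 < s k ∧ s k ≤ 2)
    (Tk : ∀ k : Fin m, X k.castSucc →L[ℂ] X k.succ)
    (hTk : ∀ k, IsTwoNuclear (s k) (Tk k))
    (T : X 0 →L[ℂ] X 0)
    (hT : T = (e : X (Fin.last m) →L[ℂ] X 0).comp (operatorProduct X Tk (Fin.last m)))
    (hfin : FiniteDimensional ℂ (LinearMap.range (T : X 0 →ₗ[ℂ] X 0)))
    (st : ℝ) (hst : 1 / st = ∑ k, 1 / s k)
    (t : ℝ) (ht : 0 < t) (htst : t ≤ st) :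
    (∃ lam, IsEigenvalueSeq T lam) ∧
    ∀ lam, IsEigenvalueSeq T lam →
      (Summable fun n => ‖lam n‖ ^ t) ∧
      lpQuasiNorm t lam ≤
        (Module.finrank ℂ (LinearMap.range (T : X 0 →ₗ[ℂ] X 0)) : ℝ) ^ (1 / t - 1 / st) *
          ∏ k, twoNuclearNorm (s k) (Tk k) ∧
      (Summable fun n => ‖lam n‖ ^ st) ∧
      lpQuasiNorm st lam ≤
        (Module.finrank ℂ (LinearMap.range (T : X 0 →ₗ[ℂ] X 0)) : ℝ) ^ (1 / t - 1 / st) *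
          ∏ k, twoNuclearNorm (s k) (Tk k) := by
  obtain ⟨m, rfl⟩ : ∃ m', m = m' + 1 := ⟨m - 1, by omega⟩
  have hst0 : 0 < st := ht.trans_le htst
  obtain ⟨v, μ, hv, hμ, hmult⟩ := exists_triangular_family_range T hfin
  generalize Module.finrank ℂ (LinearMap.range (T : X 0 →ₗ[ℂ] X 0)) = d at v μ hv hμ hmult ⊢
  have hbound : (∑ j, ‖μ j‖ ^ st) ^ (1 / st) ≤ ∏ k, twoNuclearNorm (s k) (Tk k) := by
    refine le_prod_sInf (fun k => ?_) (fun k c hc => ?_) fun c hc => ?_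
    · obtain ⟨a, x', y, h, hy⟩ := (hTk k).exists_normalized
      exact ⟨_, a, x', y, h, hy, rfl⟩
    · obtain ⟨a, -, -, -, -, rfl⟩ := hc
      exact lpQuasiNorm_nonneg _ _
    · choose a x' y hrep hy hca using hc
      have h := sum_norm_rpow_le_of_reps X e s hs Tk T hT a x' y hrep hy hv hμ hst0 hst
      simp only [hca]
      rw [one_div, Real.rpow_inv_le_iff_of_pos (Finset.sum_nonneg fun j _ =>
        Real.rpow_nonneg (norm_nonneg _) _)
        (Finset.prod_nonneg fun k _ => lpQuasiNorm_nonneg _ _) hst0]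
      exact h
  -- An eigenvalue sequence is the diagonal padded with zeros; any other has the same nonzero
  -- entries up to order.
  refine ⟨⟨fun n => if h : n < d then μ ⟨n, h⟩ else 0, fun z hz => ?_⟩, fun lam hlam => ?_⟩
  · rw [← hmult z hz, ← Fin.val_injective.encard_image]
    congr 1
    ext n
    simp only [Set.mem_image, Set.mem_ofPred_eq]
    constructor
    · intro h
      by_cases hn : n < d
      · exact ⟨⟨n, hn⟩, by simpa [hn] using h, rfl⟩
      · simp only [hn, dite_false] at h
        exact absurd h.symm hz
    · rintro ⟨j, hj, rfl⟩
      simpa using hj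
  · have hfib : ∀ z ≠ 0, {k | lam k = z}.encard = {j | μ j = z}.encard := fun z hz =>
      (hlam z hz).trans (hmult z hz).symm
    have h1 := hasSum_norm_rpow_of_encard_fiber_eq hfib ht
    have h2 := hasSum_norm_rpow_of_encard_fiber_eq hfib hst0
    refine ⟨h1.summable, ?_, h2.summable, ?_⟩
    · rw [lpQuasiNorm, h1.tsum_eq]
      refine (rpow_sum_rpow_le_card_mul (fun j => norm_nonneg (μ j)) ht htst).trans ?_
      rw [Fintype.card_fin]
      exact mul_le_mul_of_nonneg_left hbound (Real.rpow_nonneg (Nat.cast_nonneg _) _)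
    · rw [lpQuasiNorm, h2.tsum_eq]
      have hprod : 0 ≤ ∏ k, twoNuclearNorm (s k) (Tk k) :=
        le_trans (Real.rpow_nonneg (Finset.sum_nonneg fun j _ =>
          Real.rpow_nonneg (norm_nonneg _) _) _) hbound
      -- For `d = 0` the dimension factor need not be at least `1`, but the left side is then zero.
      rcases Nat.eq_zero_or_pos d with h0 | hpos
      · have : IsEmpty (Fin d) := by rw [h0]; infer_instance
        rw [Finset.univ_eq_empty, Finset.sum_empty, Real.zero_rpow (one_div_pos.2 hst0).ne']
        exact mul_nonneg (Real.rpow_nonneg (Nat.cast_nonneg _) _) hprod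
      · refine hbound.trans (le_mul_of_one_le_left hprod (Real.one_le_rpow ?_ ?_))
        · exact_mod_cast hpos
        · exact sub_nonneg.2 (one_div_le_one_div_of_le ht htst)
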